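/- Let $(X,d_X)$ be a locally compact, separable metric space and let $\mu$ be a Borel regular measure on $X$ such that $0<\mu(B(x,r))<\infty$ for every $x\in X$ and $r>0$. Let $\mathcal{M}$ be the set of all finite Borel measures $\nu$ on $X$ with compact support and $0\le \nu\le\mu$, and write $\|\nu\|=\nu(X)$. Fix a strictly increasing continuous function $h:[0,\infty)\to[0,\infty)$ with $h(0)=\lim_{\varepsilon\to0^+}h(\varepsilon)/\varepsilon=0$, with $h(\varepsilon_1)+h(\varepsilon_2)\le h(\varepsilon_1+\varepsilon_2)$ for all $\varepsilon_1,\varepsilon_2\ge 0$, and with $\lim_{\varepsilon\to\infty}h(\varepsilon)=\infty$. For $\nu,\eta\in\mathcal{M}$ let $d_{\mathcal{M}}(\nu,\eta)$ be the infimum of all $\varepsilon>0$ for which there are an at most countable family $(\nu_i,\eta_i)_{i\in I}$ of pairs of elements of $\mathcal{M}$ such that $\nu=\sum_i\nu_i$, $\eta=\sum_i\eta_i$, $\sum_i\bigl|\|\nu_i\|-\|\eta_i\|\bigr|\le h(\varepsilon)$, and $\operatorname{diam}(\operatorname{supp}\nu_i\cup\operatorname{supp}\eta_i)\le\varepsilon$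 for every $i$. For $A\subset X$ and $\varepsilon\ge0$ let $A_\varepsilon=\{y\in X:\operatorname{dist}(y,A)\le\varepsilon\}$ (so $\emptyset_\varepsilon=\emptyset$). Let $b\ge 0$ and let $\eta:[0,b]\to\mathcal{M}$ be $1$-Lipschitz, i.e. $d_{\mathcal{M}}(\eta(t),\eta(s))\le t-s$ whenever $0\le s\le t\le b$. Then: 1. $\|\eta(t)\|$ is constant on $[0,b]$. 2. If $s,t\in[0,b]$ and $|s-t|<\varepsilon$, then $\operatorname{supp}\eta(t)\subset(\operatorname{supp}\eta(s))_\varepsilon$. 3. The set $\bigcup_{s\in[0,b]}\operatorname{supp}\eta(s)$ is compact. -/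

import Mathlib

open Set Filter Topology MeasureTheory
open scoped NNReal ENNReal

/-- The standing assumption on the measure of the metric measure space: every ball (of positive
radius) has positive and finite measure.  (A Mathlib measure on a Borel space is automatically
Borel regular, since its value on an arbitrary set is the infimum over measurable supersets.) -/
def PosFiniteOnBalls {X : Type*} [MetricSpace X] [MeasurableSpace X] (μ : Measure X) : Prop :=
  ∀ (x : X) (r : ℝ), 0 < r → 0 < μ (Metric.ball x r) ∧ μ (Metric.ball x r) < ∞

/-- The admissible functions `h : [0, ∞) → [0, ∞)`. -/
structure IsMassGauge (h : ℝ≥0 → ℝ≥0) : Prop where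
  strictMono : StrictMono h
  continuous : Continuous h
  map_zero : h 0 = 0
  tendsto_div_zero : Tendsto (fun ε : ℝ≥0 => h ε / ε) (𝓝[>] 0) (𝓝 0)
  superadditive : ∀ ε₁ ε₂ : ℝ≥0, h ε₁ + h ε₂ ≤ h (ε₁ + ε₂)
  tendsto_atTop : Tendsto h atTop atTop

/-- `𝓟`: finite Borel measures with compact support. -/
def compactMeasures (X : Type*) [MetricSpace X] [MeasurableSpace X] : Set (Measure X) :=
  {ν | IsFiniteMeasure ν ∧ IsCompact ν.support}

/-- `𝓜 = {ν ∈ 𝓟 : 0 ≤ ν ≤ μ}`. -/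
def subMeasures {X : Type*} [MetricSpace X] [MeasurableSpace X] (μ : Measure X) :
    Set (Measure X) :=
  {ν | ν ∈ compactMeasures X ∧ ν ≤ μ}

/-- The total mass `‖ν‖` of a (finite) measure. -/
noncomputable def totalMass {X : Type*} [MeasurableSpace X] (ν : Measure X) : ℝ :=
  ν.real univ

/-- `(νᵢ, ηᵢ)_{i ∈ ι}` belongs to `Γ_{ε,δ}(ν, η)`. -/
structure IsDecomposition {X : Type*} [MetricSpace X] [MeasurableSpace X] (μ : Measure X)
    (ε δ : ℝ≥0) (ν η : Measure X) {ι : Type} (νs ηs : ι → Measure X) : Prop where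
  countable : Countable ι
  left_mem : ∀ i, νs i ∈ subMeasures μ
  right_mem : ∀ i, ηs i ∈ subMeasures μ
  left_sum : ν = Measure.sum νs
  right_sum : η = Measure.sum ηs
  mass_diff : ∑' i, ENNReal.ofReal |totalMass (νs i) - totalMass (ηs i)| ≤ (δ : ℝ≥0∞)
  diam_le : ∀ i, Metric.ediam ((νs i).support ∪ (ηs i).support) ≤ (ε : ℝ≥0∞)

/-- `d_𝓜(ν, η) = inf {ε > 0 : Γ_{ε,h(ε)}(ν, η) ≠ ∅}`. -/
noncomputable def massDist {X : Type*} [MetricSpace X] [MeasurableSpace X] (μ : Measure X)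
    (h : ℝ≥0 → ℝ≥0) (ν η : Measure X) : ℝ≥0 :=
  sInf {ε : ℝ≥0 | 0 < ε ∧
    ∃ (ι : Type) (νs ηs : ι → Measure X), IsDecomposition μ ε (h ε) ν η νs ηs}

/-- A map `η : [0, b] → 𝓜` is a curve subparametrized by arc-length if it is 1-Lipschitz for
`d_𝓜`.  (Its length is then at most `b`, so it is rectifiable.) -/
def IsSubArcLengthCurve {X : Type*} [MetricSpace X] [MeasurableSpace X] (μ : Measure X)
    (h : ℝ≥0 → ℝ≥0) {b : ℝ} (η : Icc (0 : ℝ) b → subMeasures μ) : Prop :=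
  ∀ s t : Icc (0 : ℝ) b, s ≤ t →
    (massDist μ h (η t : Measure X) (η s : Measure X) : ℝ) ≤ (t : ℝ) - (s : ℝ)

/-! A decomposition at scale `δ` bounds the mass of `B` by the other measure's mass of the
`δ`-thickening of `B`, plus `h δ`. Cut the time between `s` and `t` into `n + 1` equal steps and
chain these bounds with `δ = ε / (n + 1)`: the thickenings add up to `ε`, while the errors add up to
`(n + 1) * h (ε / (n + 1))`, which vanishes in the limit because `h` is sublinear at `0`. The
resulting error-free bound, `IsSubArcLengthCurve.measure_le`, gives constant mass for `B = univ` and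
the support inclusion for small balls `B`. Compactness follows by extracting subsequences, first in
time, then in a limiting support. -/

theorem IsDecomposition.symm {X : Type*} [MetricSpace X] [MeasurableSpace X] {μ : Measure X}
    {ε δ : ℝ≥0} {ν η : Measure X} {ι : Type} {νs ηs : ι → Measure X}
    (H : IsDecomposition μ ε δ ν η νs ηs) : IsDecomposition μ ε δ η ν ηs νs where
  countable := H.countable
  left_mem := H.right_mem
  right_mem := H.left_mem
  left_sum := H.right_sum
  right_sum := H.left_sum
  mass_diff := by simpa only [abs_sub_comm] using H.mass_diff
  diam_le i := by simpa only [union_comm] using H.diam_le i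

/-- A Prokhorov-type estimate: a decomposition moves mass by at most `ε`, up to an error `δ`. -/
theorem IsDecomposition.measure_le {X : Type*} [MetricSpace X]
    [TopologicalSpace.SeparableSpace X] [MeasurableSpace X] {μ : Measure X}
    {ε δ : ℝ≥0} {ν η : Measure X} {ι : Type} {νs ηs : ι → Measure X}
    (H : IsDecomposition μ ε δ ν η νs ηs) (B : Set X) :
    ν B ≤ η (Metric.cthickening ε B) + δ := by
  have : SecondCountableTopology X := UniformSpace.secondCountable_of_separable X
  have := H.countable
  rw [H.left_sum, H.right_sum, Measure.sum_apply_of_countable, Measure.sum_apply_of_countable]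
  refine le_trans ?_ (add_le_add le_rfl H.mass_diff)
  rw [← ENNReal.tsum_add]
  refine ENNReal.tsum_le_tsum fun i => ?_
  -- A piece that charges `B` has a support point in `B`, so the diameter bound puts its whole
  -- partner inside the thickening.
  by_cases hB : νs i B = 0
  · simp [hB]
  obtain ⟨x, hxB, hx⟩ : (B ∩ (νs i).support).Nonempty :=
    Measure.nonempty_inter_support_of_pos (pos_iff_ne_zero.2 hB)
  have hsub : (ηs i).support ⊆ Metric.cthickening ε B := fun y hy => by
    refine Metric.mem_cthickening_of_edist_le y x ε B hxB ?_
    rw [ENNReal.ofReal_coe_nnreal]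
    exact (Metric.edist_le_ediam_of_mem (mem_union_right _ hy) (mem_union_left _ hx)).trans (H.diam_le i)
  have h₁ : ηs i univ ≤ ηs i (Metric.cthickening ε B) := by
    calc ηs i univ ≤ ηs i (Metric.cthickening ε B ∪ (ηs i).supportᶜ) :=
          measure_mono fun y _ => (em (y ∈ (ηs i).support)).imp (fun hy => hsub hy) id
      _ ≤ _ := (measure_union_le _ _).trans (by simp [Measure.measure_compl_support])
  have := (H.left_mem i).1.1
  have := (H.right_mem i).1.1
  calc νs i B ≤ νs i univ := measure_mono (subset_univ _)
    _ = ENNReal.ofReal (totalMass (νs i)) := by simp [totalMass]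
    _ ≤ ENNReal.ofReal (totalMass (ηs i) + |totalMass (νs i) - totalMass (ηs i)|) :=
        ENNReal.ofReal_le_ofReal (by linarith [le_abs_self (totalMass (νs i) - totalMass (ηs i))])
    _ ≤ ENNReal.ofReal (totalMass (ηs i)) +
          ENNReal.ofReal |totalMass (νs i) - totalMass (ηs i)| := ENNReal.ofReal_add_le
    _ = ηs i univ + ENNReal.ofReal |totalMass (νs i) - totalMass (ηs i)| := by simp [totalMass]
    _ ≤ _ := by gcongr

/-- A single pair suffices, as `h` is unbounded. This rules out the junk value `sInf ∅ = 0` in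
`massDist`. -/
theorem exists_isDecomposition {X : Type*} [MetricSpace X] [MeasurableSpace X] {μ : Measure X}
    {h : ℝ≥0 → ℝ≥0} (hh : IsMassGauge h) {ν η : Measure X}
    (hν : ν ∈ subMeasures μ) (hη : η ∈ subMeasures μ) :
    ∃ ε : ℝ≥0, 0 < ε ∧
      ∃ (ι : Type) (νs ηs : ι → Measure X), IsDecomposition μ ε (h ε) ν η νs ηs := by
  have hd : Metric.ediam (ν.support ∪ η.support) ≠ ∞ :=
    (hν.1.2.union hη.1.2).isBounded.ediam_ne_top
  obtain ⟨ε, ⟨hε, hεd⟩, hεm⟩ := (((eventually_gt_atTop (0 : ℝ≥0)).and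
    (eventually_ge_atTop (Metric.ediam (ν.support ∪ η.support)).toNNReal)).and
    (hh.tendsto_atTop.eventually_ge_atTop |totalMass ν - totalMass η|.toNNReal)).exists
  refine ⟨ε, hε, Unit, fun _ => ν, fun _ => η, inferInstance, fun _ => hν, fun _ => hη, ?_, ?_,
    ?_, fun _ => ?_⟩
  · simp
  · simp
  · simpa [ENNReal.ofReal] using hεm
  · rw [← ENNReal.coe_toNNReal hd]
    exact_mod_cast hεd

theorem exists_isDecomposition_lt {X : Type*} [MetricSpace X] [MeasurableSpace X] {μ : Measure X}
    {h : ℝ≥0 → ℝ≥0} (hh : IsMassGauge h) {ν η : Measure X}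
    (hν : ν ∈ subMeasures μ) (hη : η ∈ subMeasures μ) {δ : ℝ≥0} (hδ : massDist μ h ν η < δ) :
    ∃ ε < δ, ∃ (ι : Type) (νs ηs : ι → Measure X), IsDecomposition μ ε (h ε) ν η νs ηs := by
  obtain ⟨ε, ⟨-, H⟩, hε⟩ := exists_lt_of_csInf_lt (exists_isDecomposition hh hν hη) hδ
  exact ⟨ε, hε, H⟩

theorem IsSubArcLengthCurve.measure_le_add {X : Type*} [MetricSpace X]
    [TopologicalSpace.SeparableSpace X] [MeasurableSpace X] {μ : Measure X}
    {h : ℝ≥0 → ℝ≥0} (hh : IsMassGauge h) {b : ℝ} {η : Icc (0 : ℝ) b → subMeasures μ}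
    (hη : IsSubArcLengthCurve μ h η) {s t : Icc (0 : ℝ) b} {δ : ℝ≥0}
    (hst : |(s : ℝ) - t| < δ) (B : Set X) :
    (η t : Measure X) B ≤ (η s : Measure X) (Metric.cthickening δ B) + h δ := by
  have key : ∃ ε < δ, ∃ (ι : Type) (νs ηs : ι → Measure X),
      IsDecomposition μ ε (h ε) (η t : Measure X) (η s) νs ηs := by
    rcases le_total s t with hle | hle
    · refine exists_isDecomposition_lt hh (η t).2 (η s).2 (NNReal.coe_lt_coe.1 ?_)
      exact (hη s t hle).trans_lt (by linarith [neg_abs_le ((s : ℝ) - t)])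
    · obtain ⟨ε, hε, ι, νs, ηs, H⟩ := exists_isDecomposition_lt hh (η s).2 (η t).2
        (NNReal.coe_lt_coe.1 ((hη t s hle).trans_lt ((le_abs_self _).trans_lt hst)))
      exact ⟨ε, hε, ι, ηs, νs, H.symm⟩
  obtain ⟨ε, hε, ι, νs, ηs, H⟩ := key
  refine (H.measure_le B).trans (add_le_add (measure_mono ?_) ?_)
  · exact Metric.cthickening_mono (NNReal.coe_le_coe.2 hε.le) B
  · exact_mod_cast (hh.strictMono hε).le

theorem IsSubArcLengthCurve.measure_le_add_nsmul {X : Type*} [MetricSpace X]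
    [TopologicalSpace.SeparableSpace X] [MeasurableSpace X] {μ : Measure X}
    {h : ℝ≥0 → ℝ≥0} (hh : IsMassGauge h) {b : ℝ} {η : Icc (0 : ℝ) b → subMeasures μ}
    (hη : IsSubArcLengthCurve μ h η) {δ : ℝ≥0} (B : Set X) (n : ℕ) {s t : Icc (0 : ℝ) b}
    (hst : |(s : ℝ) - t| < (n + 1) * δ) :
    (η t : Measure X) B ≤
      (η s : Measure X) (Metric.cthickening ((n + 1) * δ) B) + (n + 1) * h δ := by
  induction n generalizing s with
  | zero => simpa using hη.measure_le_add hh (by simpa using hst) B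
  | succ n ih =>
    have hn : (0 : ℝ) < n + 1 + 1 := by positivity
    push_cast at hst ⊢
    -- `u` is the first of the `n + 2` equal steps from `s` to `t`.
    obtain ⟨u, hu⟩ : ∃ u : Icc (0 : ℝ) b, (s : ℝ) - u = (s - t) / (n + 1 + 1) := by
      have hc := (convex_Icc (0 : ℝ) b) s.2 t.2 (a := ((n : ℝ) + 1) / (n + 1 + 1))
        (b := 1 / ((n : ℝ) + 1 + 1)) (by positivity) (by positivity) (by field_simp)
      refine ⟨⟨_, hc⟩, ?_⟩
      simp only [smul_eq_mul]
      field_simp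
      ring
    have hsu : |(s : ℝ) - u| < δ := by
      rw [hu, abs_div, abs_of_pos hn, div_lt_iff₀ hn]
      linarith
    have hut : |(u : ℝ) - t| < (n + 1) * δ := by
      have : (u : ℝ) - t = (n + 1) * (s - u) := by
        rw [eq_div_iff hn.ne'] at hu
        linarith
      rw [this, abs_mul, abs_of_pos (by positivity : (0 : ℝ) < n + 1)]
      gcongr
    calc (η t : Measure X) B
        ≤ (η u : Measure X) (Metric.cthickening ((n + 1) * δ) B) + (n + 1) * h δ := ih hut
      _ ≤ (η s : Measure X) (Metric.cthickening δ (Metric.cthickening ((n + 1) * δ) B)) + h δ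
            + (n + 1) * h δ := by
          gcongr
          exact hη.measure_le_add hh hsu _
      _ ≤ (η s : Measure X) (Metric.cthickening ((n + 1 + 1) * δ) B) + h δ
            + (n + 1) * h δ := by
          gcongr
          refine (Metric.cthickening_cthickening_subset δ.coe_nonneg (by positivity) B).trans_eq ?_
          rw [add_one_mul ((n : ℝ) + 1), add_comm]
      _ = _ := by ring

theorem IsMassGauge.tendsto_mul_div {h : ℝ≥0 → ℝ≥0} (hh : IsMassGauge h) {ε : ℝ≥0}
    (hε : 0 < ε) :
    Tendsto (fun n : ℕ => ((n : ℝ≥0) + 1) * h (ε / (n + 1))) atTop (𝓝 0) := by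
  have h₁ : Tendsto (fun n : ℕ => ε / ((n : ℝ≥0) + 1)) atTop (𝓝[>] 0) := by
    refine tendsto_nhdsWithin_iff.2 ⟨?_, .of_forall fun n => ?_⟩
    · rw [← NNReal.tendsto_coe]
      push_cast
      exact tendsto_const_nhds.div_atTop
        (tendsto_atTop_add_const_right _ _ tendsto_natCast_atTop_atTop)
    · exact div_pos hε (by positivity)
  have h₂ := (hh.tendsto_div_zero.comp h₁).const_mul ε
  rw [mul_zero] at h₂
  refine h₂.congr fun n => ?_
  have : (n : ℝ≥0) + 1 ≠ 0 := by positivity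
  simp only [Function.comp]
  field_simp

/-- Along a 1-Lipschitz curve, mass moves at unit speed without any loss. -/
theorem IsSubArcLengthCurve.measure_le {X : Type*} [MetricSpace X]
    [TopologicalSpace.SeparableSpace X] [MeasurableSpace X] {μ : Measure X}
    {h : ℝ≥0 → ℝ≥0} (hh : IsMassGauge h) {b : ℝ} {η : Icc (0 : ℝ) b → subMeasures μ}
    (hη : IsSubArcLengthCurve μ h η) {s t : Icc (0 : ℝ) b} {ε : ℝ}
    (hst : |(s : ℝ) - t| < ε) (B : Set X) :
    (η t : Measure X) B ≤ (η s : Measure X) (Metric.cthickening ε B) := by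
  have hε : 0 < ε := (abs_nonneg _).trans_lt hst
  lift ε to ℝ≥0 using hε.le
  have hlim : Tendsto (fun n : ℕ => (η s : Measure X) (Metric.cthickening ε B) +
      (((n : ℝ≥0) + 1) * h (ε / (n + 1)) : ℝ≥0)) atTop
      (𝓝 ((η s : Measure X) (Metric.cthickening ε B) + (0 : ℝ≥0))) :=
    tendsto_const_nhds.add (ENNReal.tendsto_coe.2 (hh.tendsto_mul_div (by exact_mod_cast hε)))
  rw [ENNReal.coe_zero, add_zero] at hlim
  refine ge_of_tendsto' hlim fun n => ?_
  have hn : ((n : ℝ) + 1) * ((ε / (n + 1) : ℝ≥0) : ℝ) = ε := by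
    push_cast
    field_simp
  have := hη.measure_le_add_nsmul hh (δ := ε / (n + 1)) B n (hn ▸ hst)
  rw [hn] at this
  exact_mod_cast this

theorem IsSubArcLengthCurve.support_subset {X : Type*} [MetricSpace X]
    [TopologicalSpace.SeparableSpace X] [MeasurableSpace X] {μ : Measure X}
    {h : ℝ≥0 → ℝ≥0} (hh : IsMassGauge h) {b : ℝ} {η : Icc (0 : ℝ) b → subMeasures μ}
    (hη : IsSubArcLengthCurve μ h η) {s t : Icc (0 : ℝ) b} {ε : ℝ}
    (hst : |(s : ℝ) - t| < ε) :
    (η t : Measure X).support ⊆ Metric.cthickening ε (η s : Measure X).support := by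
  have : SecondCountableTopology X := UniformSpace.secondCountable_of_separable X
  intro x hx
  -- The budget `ε` is split: `r` for the motion of mass, `ε - r` for the radius of a ball around
  -- `x`.
  obtain ⟨r, hsr, hr⟩ := exists_between hst
  have hpos : 0 < (η t : Measure X) (Metric.ball x (ε - r)) :=
    (Measure.mem_support_iff_forall x).1 hx _ (Metric.ball_mem_nhds x (sub_pos.2 hr))
  have hpos' := hpos.trans_le (hη.measure_le hh hsr _)
  obtain ⟨z, hz, hzs⟩ : (Metric.cthickening r (Metric.ball x (ε - r)) ∩
      (η s : Measure X).support).Nonempty :=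
    Measure.nonempty_inter_support_of_pos hpos'
  have hr₀ : 0 ≤ r := (abs_nonneg _).trans hsr.le
  have hz' : z ∈ Metric.cthickening (r + (ε - r)) {x} := by
    refine Metric.cthickening_cthickening_subset hr₀ (sub_nonneg.2 hr.le) _
      (Metric.cthickening_subset_of_subset _ ?_ hz)
    rw [Metric.cthickening_singleton _ (sub_nonneg.2 hr.le)]
    exact Metric.ball_subset_closedBall
  rw [add_sub_cancel, Metric.cthickening_singleton _ (hr₀.trans hr.le)] at hz'
  exact Metric.mem_cthickening_of_dist_le x z ε _ hzs (by rw [dist_comm]; exact hz')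

/-- The union of an upper semicontinuous family of compact sets over a compact metric space is
compact. -/
theorem isCompact_iUnion_of_subset_cthickening {T X : Type*} [PseudoMetricSpace T]
    [CompactSpace T] [PseudoMetricSpace X] {K : T → Set X} (hK : ∀ s, IsCompact (K s))
    (hsub : ∀ (s t : T) (ε : ℝ), dist s t < ε → K t ⊆ Metric.cthickening ε (K s)) :
    IsCompact (⋃ s, K s) := by
  refine IsSeqCompact.isCompact fun x hx => ?_
  choose s hs using fun n => mem_iUnion.1 (hx n)
  obtain ⟨a, -, φ, hφ, ha⟩ := isCompact_univ.tendsto_subseq fun n => mem_univ (s n)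
  -- The term `1 / (n + 1)` makes the inequality required by `hsub` strict and the radius positive.
  have hy : ∀ n, ∃ y ∈ K a, dist (x (φ n)) y ≤ dist a (s (φ n)) + 1 / ((n : ℝ) + 1) := by
    intro n
    have hn : (0 : ℝ) < 1 / ((n : ℝ) + 1) := by positivity
    have := hsub a (s (φ n)) _ (lt_add_of_pos_right _ hn) (hs (φ n))
    rw [(hK a).cthickening_eq_biUnion_closedBall (by positivity)] at this
    simpa using this
  choose y hyK hy using hy
  obtain ⟨z, hz, ψ, hψ, hyz⟩ := (hK a).tendsto_subseq hyK
  refine ⟨z, mem_iUnion.2 ⟨a, hz⟩, φ ∘ ψ, hφ.comp hψ, ?_⟩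
  have hlim : Tendsto (fun n => dist a (s (φ n)) + 1 / ((n : ℝ) + 1)) atTop (𝓝 0) := by
    have h₁ : Tendsto (fun n => dist a (s (φ n))) atTop (𝓝 0) := by
      simpa using (tendsto_const_nhds (x := a)).dist ha
    simpa using h₁.add tendsto_one_div_add_atTop_nhds_zero_nat
  have hd : Tendsto (fun n => dist (y n) (x (φ n))) atTop (𝓝 0) :=
    squeeze_zero (fun _ => dist_nonneg) (fun n => by rw [dist_comm]; exact hy n) hlim
  exact (tendsto_iff_of_dist (hd.comp hψ.tendsto_atTop)).1 hyz

theorem mainTheorem9 {X : Type*} [MetricSpace X] [LocallyCompactSpace X]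
    [TopologicalSpace.SeparableSpace X] [MeasurableSpace X] [BorelSpace X]
    (μ : Measure X) (hμ : PosFiniteOnBalls μ)
    (h : ℝ≥0 → ℝ≥0) (hh : IsMassGauge h)
    (b : ℝ) (hb : 0 ≤ b) (η : Icc (0 : ℝ) b → subMeasures μ)
    (hη : IsSubArcLengthCurve μ h η) :
    (∀ s t : Icc (0 : ℝ) b, totalMass (η s : Measure X) = totalMass (η t : Measure X)) ∧
    (∀ (s t : Icc (0 : ℝ) b) (ε : ℝ), |(s : ℝ) - (t : ℝ)| < ε →
      (η t : Measure X).support ⊆ Metric.cthickening ε (η s : Measure X).support) ∧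
    IsCompact (⋃ s : Icc (0 : ℝ) b, (η s : Measure X).support) := by
  have hle : ∀ s t : Icc (0 : ℝ) b, (η t : Measure X) univ ≤ (η s : Measure X) univ :=
    fun s t => (hη.measure_le hh (lt_add_one _) univ).trans (measure_mono (subset_univ _))
  refine ⟨fun s t => ?_, fun s t ε hst => hη.support_subset hh hst, ?_⟩
  · exact congrArg ENNReal.toReal (le_antisymm (hle t s) (hle s t))
  · exact isCompact_iUnion_of_subset_cthickening (fun s => (η s).2.1.2)
      fun s t ε hst => hη.support_subset hh hst
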